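/- Let $\Phi(z,s,v)$ denote the Lerch function: $\Phi(z,s,v)=\sum_{k\ge 0} z^k (v+k)^{-s}$ for $|z|<1$, $v\notin\{0,-1,-2,\dots\}$, continued analytically (for $\operatorname{Re}s>0$) to $z\in\mathbb{C}\setminus[1,\infty)$ by $$\Phi(z,s,v)=\frac1{\Gamma(s)}\int_0^\infty \frac{t^{s-1}e^{-vt}}{1-ze^{-t}}\,dt\quad(\operatorname{Re}v>0),\qquad \Phi(z,s,v)=\sum_{k=0}^{N-1}z^k(v+k)^{-s}+z^N\,\Phi(z,s,v+N).$$ Let $m,n,l,a\in\mathbb{C}$ satisfy $\operatorname{Re}a>0$ and, for both $j=m$ and $j=n$, $$0<\operatorname{Re}(2j+1)<2\operatorname{Re}l,\qquad\text{and}\qquad \operatorname{Im}\frac{2j+1}{l}>0\ \text{ or }\ 0<\operatorname{Re}\frac{2j+1}{l}<2$$ (the last condition holds automatically if $l$ is real). Then the following integral converges absolutely, and $$\int_0^\infty\left(\frac{\log(x)\,(x^{2n}-x^{2m})}{(x^{2l}-1)(a^2+\log^2 x)}+\frac{ia\,(x^{2m}-x^{2n})}{(x^{2l}-1)(a^2+\log^2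 x)}\right)dx$$ $$=e^{\frac{i\pi}{l}}\left(e^{\frac{2i\pi n}{l}}\,\Phi\!\left(e^{\frac{i(2n+1)\pi}{l}},1,\frac{al}{\pi}+1\right)-e^{\frac{2i\pi m}{l}}\,\Phi\!\left(e^{\frac{i(2m+1)\pi}{l}},1,\frac{al}{\pi}+1\right)\right).$$ -/

import Mathlib

/-- The Lerch function `Φ(z, s, v)` for `v ∉ {0, -1, -2, …}`, with principal values of the powers.

* For `‖z‖ < 1` it is the sum of the series `∑ k, z ^ k (v + k) ^ (-s)`.
* For `‖z‖ ≥ 1` it is the analytic continuation (in the slit plane `z ∉ [1, ∞)`, with `0 < Re s`)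
  by the integral representation
  `Φ(z, s, w) = Γ(s)⁻¹ ∫ t in (0, ∞), t ^ (s - 1) e ^ (-w t) / (1 - z e ^ (-t))`, `0 < Re w`;
  it is used at `w = v + N`, where `N` is the least natural number with `0 < Re v + N`
  (so `N = 0` if `0 < Re v`), and the first `N` terms of the series are added to `z ^ N` times it.
  This is the continuation of the series in `v`. -/
noncomputable def lerchPhi (z s v : ℂ) : ℂ :=
  if ‖z‖ < 1 then
    ∑' k : ℕ, z ^ k * (v + (k : ℂ)) ^ (-s)
  else
    let N : ℕ := ⌊1 - v.re⌋₊
    (∑ k ∈ Finset.range N, z ^ k * (v + (k : ℂ)) ^ (-s)) +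
      z ^ N * ((Complex.Gamma s)⁻¹ *
        ∫ t in Set.Ioi (0 : ℝ),
          (t : ℂ) ^ (s - 1) * Complex.exp (-(v + (N : ℂ)) * (t : ℂ)) /
            (1 - z * Complex.exp (-(t : ℂ))))

/-- The integrand
`log x (x^(2n) - x^(2m)) / ((x^(2l) - 1)(a² + log² x))
  + i a (x^(2m) - x^(2n)) / ((x^(2l) - 1)(a² + log² x))`, for `x > 0`. -/
noncomputable def logDenomIntegrand (m n l a : ℂ) (x : ℝ) : ℂ :=
  (Real.log x : ℂ) * ((x : ℂ) ^ (2 * n) - (x : ℂ) ^ (2 * m)) /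
      (((x : ℂ) ^ (2 * l) - 1) * (a ^ 2 + (Real.log x : ℂ) ^ 2)) +
    Complex.I * a * ((x : ℂ) ^ (2 * m) - (x : ℂ) ^ (2 * n)) /
      (((x : ℂ) ^ (2 * l) - 1) * (a ^ 2 + (Real.log x : ℂ) ^ 2))

/-!
The substitution `x = exp t` and the factorisation `a² + t² = (t + i a) (t - i a)` turn the integral
into `∫ g t / (t + i a)` over `ℝ`, where `g t = (exp (N t) - exp (M t)) / (exp (2 l t) - 1)`,
`N = 2 n + 1`, `M = 2 m + 1`. The function `g` is integrable: its singularity at `0` is removable,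
and `0 < Re N, Re M < 2 Re l` gives exponential decay at both ends.

Since `Re a > 0`, `1 / (t + i a) = -i ∫ exp (-a s) exp (i s t) ds` over `s > 0`, and Fubini's
theorem (`integral_div_add_I_mul`) reduces the claim to the integrals of `g t * exp (i s t)`. These
have the shape of `g` with `N`, `M` replaced by `N + i s`, `M + i s`. Expanding
`1 / (exp (2 l t) - 1)` geometrically on each half-line and integrating termwise gives the
partial fractions of the cotangent (`integral_exp_sub_exp_div_exp_sub_one`); the cotangent of
`π (N + i s) / (2 l)` is an affine function of the ratio `r / (1 - r)` with `r = z exp (-s π / l)`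
and `z = exp (i π N / l)`.

There remains, for each of `N` and `M`, the integral of the Lerch kernel
`exp (-v u) / (1 - z exp (-u))`, `v = a l / π + 1`, along the ray `u ∈ (π / l) · (0, ∞)`. If
`‖z‖ < 1`, its geometric expansion is the series of `Φ(z, 1, v)`. If `‖z‖ ≥ 1`, finitely many terms
are split off so that the real part of the parameter becomes positive, and the ray is rotated to
the positive real axis (`integral_lerchKernel_ray_eq`). No pole is crossed
(`one_sub_exp_mul_exp_neg_ne_zero_of_mem_closedSector`): here `‖z‖ ≥ 1` means `Im (N / l) ≤ 0`, so
that the hypothesis supplies `0 < Re (N / l) < 2`.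
-/

open MeasureTheory Set Filter Topology

/-! ### Half-line integrals of differences of exponentials -/

lemma norm_exp_neg_mul_sub_exp_neg_mul_le {α β : ℂ} {c t : ℝ} (hα : c ≤ α.re) (hβ : c ≤ β.re)
    (ht : 0 ≤ t) :
    ‖Complex.exp (-α * t) - Complex.exp (-β * t)‖ ≤ ‖α - β‖ * (t * Real.exp (-(c * t))) := by
  have hconv : Convex ℝ {u : ℂ | u.re ≤ -(c * t)} :=
    convex_halfSpace_le (IsLinearMap.mk Complex.add_re (fun r x => by simp)) _
  have h := Convex.norm_image_sub_le_of_norm_deriv_le (f := Complex.exp)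
    (C := Real.exp (-(c * t))) (x := -β * t) (y := -α * t)
    (fun x _ => Complex.differentiableAt_exp) (fun x hx => by
      rw [Complex.deriv_exp, Complex.norm_exp]; exact Real.exp_le_exp.2 hx) hconv
    (by simp; nlinarith) (by simp; nlinarith)
  refine h.trans (le_of_eq ?_)
  have : -α * (t : ℂ) - -β * t = -((α - β) * t) := by ring
  rw [this, norm_neg, norm_mul, Complex.norm_real, Real.norm_of_nonneg ht]
  ring

lemma integrableOn_id_mul_exp_neg {c : ℝ} (hc : 0 < c) :
    IntegrableOn (fun t : ℝ => t * Real.exp (-(c * t))) (Ioi 0) := by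
  refine (integrableOn_rpow_mul_exp_neg_mul_rpow (p := 1) (s := 1) (b := c) (by norm_num)
    one_pos hc).congr_fun (fun t _ => ?_) measurableSet_Ioi
  simp

lemma integral_id_mul_exp_neg {c : ℝ} (hc : 0 < c) :
    ∫ t in Ioi (0 : ℝ), t * Real.exp (-(c * t)) = 1 / c ^ 2 := by
  have h := Real.integral_rpow_mul_exp_neg_mul_Ioi (a := 2) two_pos hc
  rw [Real.Gamma_two, mul_one] at h
  norm_num at h
  rw [h, one_div]

lemma norm_exp_neg_mul_lt_one {L : ℂ} (hL : 0 < L.re) {t : ℝ} (ht : 0 < t) :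
    ‖Complex.exp (-L * t)‖ < 1 := by
  rw [Complex.norm_exp]
  simpa using mul_pos hL ht

lemma inv_norm_one_sub_exp_neg_mul_le {L : ℂ} (hL : 0 < L.re) {t : ℝ} (ht : 0 < t) :
    t * ‖1 - Complex.exp (-L * t)‖⁻¹ ≤ 1 / L.re + t := by
  have h1 : 1 - Real.exp (-(L.re * t)) ≤ ‖1 - Complex.exp (-L * t)‖ := by
    have := norm_sub_norm_le (1 : ℂ) (Complex.exp (-L * t))
    rw [Complex.norm_exp] at this
    simpa using this
  have hx : 0 < L.re * t := mul_pos hL ht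
  have h2 : Real.exp (-(L.re * t)) ≤ 1 / (1 + L.re * t) := by
    rw [Real.exp_neg, ← one_div]
    exact one_div_le_one_div_of_le (by linarith) (by linarith [Real.add_one_le_exp (L.re * t)])
  have h3 : L.re * t / (1 + L.re * t) ≤ ‖1 - Complex.exp (-L * t)‖ := by
    refine le_trans ?_ h1
    have : L.re * t / (1 + L.re * t) = 1 - 1 / (1 + L.re * t) := by field_simp; ring
    linarith
  have h4 : 0 < L.re * t / (1 + L.re * t) := by positivity
  calc t * ‖1 - Complex.exp (-L * t)‖⁻¹ ≤ t * (L.re * t / (1 + L.re * t))⁻¹ := by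
        gcongr
    _ = 1 / L.re + t := by field_simp

/-- The difference of the exponentials vanishes at `0` like `t`, which compensates the simple
zero of the denominator there. -/
lemma integrableOn_exp_sub_exp_div {α β L : ℂ} (hα : 0 < α.re) (hβ : 0 < β.re) (hL : 0 < L.re) :
    IntegrableOn (fun t : ℝ => (Complex.exp (-α * t) - Complex.exp (-β * t)) /
      (1 - Complex.exp (-L * t))) (Ioi 0) := by
  set c := min α.re β.re
  have hc : 0 < c := lt_min hα hβ
  have hg : IntegrableOn (fun t : ℝ => ‖α - β‖ *
      (1 / L.re * Real.exp (-(c * t)) + t * Real.exp (-(c * t)))) (Ioi 0) := by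
    refine Integrable.const_mul (Integrable.add ?_ (integrableOn_id_mul_exp_neg hc)) _
    refine Integrable.const_mul ?_ _
    simpa [IntegrableOn] using exp_neg_integrableOn_Ioi 0 hc
  refine Integrable.mono' hg (Measurable.div (by fun_prop) (by fun_prop)).aestronglyMeasurable ?_
  refine (ae_restrict_mem measurableSet_Ioi).mono fun t (ht : 0 < t) => ?_
  rw [norm_div, div_eq_mul_inv]
  calc _ ≤ ‖α - β‖ * (t * Real.exp (-(c * t))) * ‖1 - Complex.exp (-L * t)‖⁻¹ := by
        gcongr
        exact norm_exp_neg_mul_sub_exp_neg_mul_le (min_le_left _ _) (min_le_right _ _) ht.le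
    _ = ‖α - β‖ * Real.exp (-(c * t)) * (t * ‖1 - Complex.exp (-L * t)‖⁻¹) := by ring
    _ ≤ ‖α - β‖ * Real.exp (-(c * t)) * (1 / L.re + t) := by
        gcongr
        exact inv_norm_one_sub_exp_neg_mul_le hL ht
    _ = _ := by ring

lemma integral_exp_neg_mul_Ioi {γ : ℂ} (hγ : 0 < γ.re) :
    ∫ t in Ioi (0 : ℝ), Complex.exp (-γ * t) = 1 / γ := by
  rw [integral_exp_mul_complex_Ioi (by simpa using hγ)]
  simp [neg_div_neg_eq]

lemma integrableOn_exp_neg_mul_Ioi {γ : ℂ} (hγ : 0 < γ.re) :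
    IntegrableOn (fun t : ℝ => Complex.exp (-γ * t)) (Ioi 0) :=
  integrableOn_exp_mul_complex_Ioi (by simpa using hγ) 0

/-- Termwise integration of the geometric expansion of `1 / (1 - exp (-L t))`. Only the
difference of the two exponentials makes the series of integrals converge absolutely. -/
lemma hasSum_integral_exp_sub_exp_div {α β L : ℂ} (hα : 0 < α.re) (hβ : 0 < β.re)
    (hL : 0 < L.re) :
    HasSum (fun k : ℕ => 1 / (α + L * k) - 1 / (β + L * k))
      (∫ t in Ioi (0 : ℝ), (Complex.exp (-α * t) - Complex.exp (-β * t)) /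
        (1 - Complex.exp (-L * t))) := by
  set c := min α.re β.re
  have hc : 0 < c := lt_min hα hβ
  have hre (γ : ℂ) (k : ℕ) : (γ + L * k).re = γ.re + L.re * k := by simp
  have hpos (γ : ℂ) (hγ : 0 < γ.re) (k : ℕ) : 0 < (γ + L * k).re := by
    rw [hre]; positivity
  let F : ℕ → ℝ → ℂ := fun k t => Complex.exp (-(α + L * k) * t) - Complex.exp (-(β + L * k) * t)
  have hF : ∀ k, IntegrableOn (F k) (Ioi 0) := fun k =>
    (integrableOn_exp_neg_mul_Ioi (hpos α hα k)).sub (integrableOn_exp_neg_mul_Ioi (hpos β hβ k))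
  have hbd : ∀ k : ℕ, ∫ t in Ioi (0 : ℝ), ‖F k t‖ ≤ ‖α - β‖ * (1 / (c + L.re * k) ^ 2) := by
    intro k
    have hck : 0 < c + L.re * k := by positivity
    rw [← integral_id_mul_exp_neg hck, ← integral_const_mul]
    refine setIntegral_mono_on (hF k).norm ((integrableOn_id_mul_exp_neg hck).const_mul _)
      measurableSet_Ioi fun t (ht : 0 < t) => ?_
    have := norm_exp_neg_mul_sub_exp_neg_mul_le (α := α + L * k) (β := β + L * k)
      (c := c + L.re * k) (t := t) (by rw [hre]; gcongr; exact min_le_left _ _)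
      (by rw [hre]; gcongr; exact min_le_right _ _) ht.le
    simpa [F] using this
  have hsum : Summable fun k : ℕ => ‖α - β‖ * (1 / (c + L.re * k) ^ 2) := by
    refine Summable.mul_left _ ?_
    have h := ((Real.summable_one_div_nat_add_rpow (c / L.re) 2).2 (by norm_num)).mul_left
      (1 / L.re ^ 2)
    refine h.congr fun k => ?_
    have : |(k : ℝ) + c / L.re| = (c + L.re * k) / L.re := by
      rw [abs_of_pos (by positivity)]; field_simp; ring
    have hck : 0 < c + L.re * k := by positivity
    rw [this, Real.rpow_two]
    field_simp
  have h := hasSum_integral_of_summable_integral_norm hF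
    (Summable.of_nonneg_of_le (fun k => by positivity) hbd hsum)
  have hterm : (fun k : ℕ => ∫ t in Ioi (0 : ℝ), F k t) =
      fun k : ℕ => 1 / (α + L * k) - 1 / (β + L * k) := by
    funext k
    rw [integral_sub (integrableOn_exp_neg_mul_Ioi (hpos α hα k))
      (integrableOn_exp_neg_mul_Ioi (hpos β hβ k)), integral_exp_neg_mul_Ioi (hpos α hα k),
      integral_exp_neg_mul_Ioi (hpos β hβ k)]
  have htotal : ∫ t in Ioi (0 : ℝ), ∑' k : ℕ, F k t =
      ∫ t in Ioi (0 : ℝ), (Complex.exp (-α * t) - Complex.exp (-β * t)) /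
        (1 - Complex.exp (-L * t)) := by
    refine setIntegral_congr_fun measurableSet_Ioi fun t (ht : 0 < t) => ?_
    have hg := (hasSum_geometric_of_norm_lt_one (norm_exp_neg_mul_lt_one hL ht)).mul_left
      (Complex.exp (-α * t) - Complex.exp (-β * t))
    simp only [div_eq_mul_inv]
    rw [← hg.tsum_eq]
    refine tsum_congr fun k => ?_
    simp only [F]
    rw [← Complex.exp_nat_mul, sub_mul, ← Complex.exp_add, ← Complex.exp_add]
    congr 2 <;> ring
  rwa [hterm, htotal] at h

/-! ### The cotangent integral over the real line -/

lemma exp_sub_exp_div_of_pos (p q L : ℂ) (t : ℝ) :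
    (Complex.exp (p * t) - Complex.exp (q * t)) / (Complex.exp (L * t) - 1) =
      (Complex.exp (-(L - p) * t) - Complex.exp (-(L - q) * t)) /
        (1 - Complex.exp (-L * t)) := by
  have e (r : ℂ) : Complex.exp (-(L - r) * t) = Complex.exp (-L * t) * Complex.exp (r * t) := by
    rw [← Complex.exp_add]; congr 1; ring
  have e2 : 1 - Complex.exp (-L * t) = Complex.exp (-L * t) * (Complex.exp (L * t) - 1) := by
    rw [mul_sub, ← Complex.exp_add]; simp
  rw [e, e, e2, ← mul_sub, mul_div_mul_left _ _ (Complex.exp_ne_zero _)]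

lemma exp_sub_exp_div_neg (p q L : ℂ) (t : ℝ) :
    (Complex.exp (p * (-t : ℝ)) - Complex.exp (q * (-t : ℝ))) / (Complex.exp (L * (-t : ℝ)) - 1) =
      -((Complex.exp (-p * t) - Complex.exp (-q * t)) / (1 - Complex.exp (-L * t))) := by
  rw [← div_neg, neg_sub]
  simp

lemma integrable_exp_sub_exp_div_exp_sub_one {p q L : ℂ} (hp : 0 < p.re)
    (hpL : p.re < L.re) (hq : 0 < q.re) (hqL : q.re < L.re) :
    Integrable (fun t : ℝ =>
      (Complex.exp (p * t) - Complex.exp (q * t)) / (Complex.exp (L * t) - 1)) := by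
  have hL : 0 < L.re := hp.trans hpL
  rw [← integrableOn_univ, ← Iic_union_Ioi (a := (0 : ℝ))]
  refine IntegrableOn.union ?_ ?_
  · have h := (integrableOn_exp_sub_exp_div hp hq hL).neg
    have h2 := ((integrableOn_Ici_iff_integrableOn_Ioi (by simp)).2 h)
    rw [← neg_zero] at h2
    refine (h2.comp_neg_Iic).congr_fun (fun t _ => ?_) measurableSet_Iic
    simpa using (exp_sub_exp_div_neg p q L (-t)).symm
  · exact (integrableOn_exp_sub_exp_div (α := L - p) (β := L - q) (by simpa using hpL)
      (by simpa using hqL) hL).congr_fun (fun t _ => (exp_sub_exp_div_of_pos p q L t).symm)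
      measurableSet_Ioi

lemma div_mem_integerComplement {p L : ℂ} (hp : 0 < p.re) (hpL : p.re < L.re) :
    p / L ∈ Complex.integerComplement := by
  rintro ⟨k, hk⟩
  have hL : L ≠ 0 := by rintro rfl; simp at hpL; linarith
  rw [eq_div_iff hL] at hk
  have h := congrArg Complex.re hk
  simp only [Complex.mul_re, Complex.intCast_re, Complex.intCast_im, zero_mul, sub_zero] at h
  have h0 : (0 : ℝ) < k := by
    by_contra hc
    push Not at hc
    nlinarith
  have h1 : (k : ℝ) < 1 := by
    by_contra hc
    push Not at hc
    nlinarith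
  norm_cast at h0 h1
  omega

/-- The partial fraction expansion of the cotangent, scaled to poles at the multiples of `L`. -/
lemma hasSum_cot_partial_fractions {p L : ℂ} (hp : 0 < p.re) (hpL : p.re < L.re) :
    HasSum (fun k : ℕ => 1 / (L - p + L * k) - 1 / (p + L * (k + 1)))
      (1 / p - Real.pi / L * Complex.cot (Real.pi * (p / L))) := by
  have hx := div_mem_integerComplement hp hpL
  have hL : L ≠ 0 := by rintro rfl; simp at hpL; linarith
  have hp0 : p ≠ 0 := by rintro rfl; simp at hp
  have h : HasSum (fun n : ℕ => 1 / (p / L - (n + 1)) + 1 / (p / L + (n + 1)))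
      (Real.pi * Complex.cot (Real.pi * (p / L)) - 1 / (p / L)) := by
    rw [cot_series_rep' hx]
    exact (summable_cotTerm hx).hasSum
  have h2 := h.mul_left (-(1 / L))
  have e : -(1 / L) * (Real.pi * Complex.cot (Real.pi * (p / L)) - 1 / (p / L)) =
      1 / p - Real.pi / L * Complex.cot (Real.pi * (p / L)) := by
    field_simp; ring
  rw [e] at h2
  refine h2.congr_fun fun k => ?_
  have e1 : L - p + L * k = -L * (p / L - (k + 1)) := by field_simp; ring
  have e2 : p + L * (k + 1) = L * (p / L + (k + 1)) := by field_simp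
  rw [e1, e2, one_div, one_div, mul_inv, mul_inv]
  simp only [one_div, inv_neg]
  ring

/-- The two half-lines contribute the poles of the cotangent at the positive and at the nonpositive
multiples of `L`, respectively. -/
lemma integral_exp_sub_exp_div_exp_sub_one {p q L : ℂ} (hp : 0 < p.re)
    (hpL : p.re < L.re) (hq : 0 < q.re) (hqL : q.re < L.re) :
    ∫ t : ℝ, (Complex.exp (p * t) - Complex.exp (q * t)) / (Complex.exp (L * t) - 1) =
      -(Real.pi / L) * (Complex.cot (Real.pi * (p / L)) - Complex.cot (Real.pi * (q / L))) := by
  have hL : 0 < L.re := hp.trans hpL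
  have hint := integrable_exp_sub_exp_div_exp_sub_one hp hpL hq hqL
  rw [← intervalIntegral.integral_Iic_add_Ioi (b := 0) hint.integrableOn hint.integrableOn]
  have s1 := hasSum_integral_exp_sub_exp_div (α := L - p) (β := L - q) (L := L)
    (by simpa using hpL) (by simpa using hqL) hL
  -- The term `k = 0` of the left half-line is split off, to match the pairing of poles in `cot`.
  have s2 := (hasSum_nat_add_iff' 1).2 (hasSum_integral_exp_sub_exp_div hp hq hL)
  have i1 : ∫ t in Ioi (0 : ℝ),
      (Complex.exp (p * t) - Complex.exp (q * t)) / (Complex.exp (L * t) - 1) = _ :=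
    setIntegral_congr_fun measurableSet_Ioi fun t _ => exp_sub_exp_div_of_pos p q L t
  have i2 : ∫ t in Iic (0 : ℝ),
      (Complex.exp (p * t) - Complex.exp (q * t)) / (Complex.exp (L * t) - 1) =
      -∫ t in Ioi (0 : ℝ), (Complex.exp (-p * t) - Complex.exp (-q * t)) /
        (1 - Complex.exp (-L * t)) := by
    have := integral_comp_neg_Ioi 0 fun t : ℝ =>
      (Complex.exp (p * t) - Complex.exp (q * t)) / (Complex.exp (L * t) - 1)
    rw [neg_zero] at this
    rw [← this, ← integral_neg]
    exact setIntegral_congr_fun measurableSet_Ioi fun t _ => exp_sub_exp_div_neg p q L t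
  have key := (s1.sub s2).unique (((hasSum_cot_partial_fractions hp hpL).sub
    (hasSum_cot_partial_fractions hq hqL)).congr_fun fun k => by push_cast; ring)
  simp only [Finset.range_one, Finset.sum_singleton, Nat.cast_zero, mul_zero, add_zero] at key
  rw [i1, i2]
  linear_combination key

/-- `cot` through the geometric ratio `w / (1 - w)` at `w = exp (2 π i x)`; the constant term
drops out of differences. -/
lemma cot_pi_mul_eq {x w : ℂ} (hw : w = Complex.exp (2 * Real.pi * Complex.I * x))
    (h1 : 1 - w ≠ 0) :
    Complex.cot (Real.pi * x) = -Complex.I * (1 + 2 * (w / (1 - w))) := by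
  rw [Complex.cot_pi_eq_exp_ratio, ← hw, div_eq_iff (mul_ne_zero Complex.I_ne_zero h1)]
  field_simp
  linear_combination (1 + w) * Complex.I_sq

/-- Division by `t + i a` is a superposition of the damped oscillations `exp (-a s) exp (i s t)`,
`s > 0`. -/
lemma integral_div_add_I_mul {g : ℝ → ℂ} (hg : Integrable g) {a : ℂ} (ha : 0 < a.re) :
    ∫ t : ℝ, g t / (t + Complex.I * a) =
      -Complex.I * ∫ s in Ioi (0 : ℝ), Complex.exp (-a * s) *
        ∫ t : ℝ, g t * Complex.exp (Complex.I * s * t) := by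
  have hF : Integrable (Function.uncurry fun (t s : ℝ) =>
      g t * Complex.exp (-(a - Complex.I * t) * s)) (volume.prod (volume.restrict (Ioi 0))) := by
    refine (hg.mul_prod (integrableOn_exp_neg_mul_Ioi ha)).norm.mono' ?_ ?_
    · refine AEStronglyMeasurable.mul hg.aestronglyMeasurable.comp_fst ?_
      exact Continuous.aestronglyMeasurable (by fun_prop)
    · refine Eventually.of_forall fun z => ?_
      simp [Function.uncurry, Complex.norm_exp]
  have hswap := integral_integral_swap hF
  have e1 : ∀ t : ℝ, ∫ s in Ioi (0 : ℝ), g t * Complex.exp (-(a - Complex.I * t) * s) =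
      Complex.I * (g t / (t + Complex.I * a)) := fun t => by
    have hre : 0 < (a - Complex.I * t).re := by simpa using ha
    have hne : a - Complex.I * t ≠ 0 := fun h => by simp [h] at hre
    have e : (t : ℂ) + Complex.I * a = Complex.I * (a - Complex.I * t) := by
      linear_combination (t : ℂ) * Complex.I_sq
    rw [integral_const_mul, integral_exp_neg_mul_Ioi hre, e]
    field_simp
  simp_rw [e1] at hswap
  rw [integral_const_mul] at hswap
  have e2 : ∀ s : ℝ, ∫ t : ℝ, g t * Complex.exp (-(a - Complex.I * t) * s) =
      Complex.exp (-a * s) * ∫ t : ℝ, g t * Complex.exp (Complex.I * s * t) := fun s => by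
    rw [← integral_const_mul]
    refine integral_congr_ae (Eventually.of_forall fun t => ?_)
    simp only
    rw [mul_left_comm, ← Complex.exp_add]
    congr 2; ring
  simp_rw [e2] at hswap
  rw [← hswap]
  linear_combination (∫ t : ℝ, g t / (t + Complex.I * a)) * Complex.I_sq

/-! ### Rotation of a ray of integration -/

/-- The closed sector spanned by the rays through `1` and `w`. -/
def closedSector (w : ℂ) : Set ℂ := {u | ∃ x y : ℝ, 0 ≤ x ∧ 0 ≤ y ∧ u = x + y * w}

lemma convex_closedSector (w : ℂ) : Convex ℝ (closedSector w) := by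
  rintro _ ⟨x, y, hx, hy, rfl⟩ _ ⟨x', y', hx', hy', rfl⟩ a b ha hb -
  exact ⟨a * x + b * x', a * y + b * y', by positivity, by positivity, by
    simp only [Complex.real_smul]; push_cast; ring⟩

/-- The primitive is only assumed along `S`, since the ray may lie on the boundary of `S`. -/
lemma integral_ray_eq_sub {F f : ℂ → ℂ} {S : Set ℂ} (hF : ∀ u ∈ S, HasDerivWithinAt F (f u) S u)
    {w : ℂ} (hw : ∀ t : ℝ, 0 ≤ t → t * w ∈ S) (hf : ContinuousOn f S) {R : ℝ} (hR : 0 ≤ R) :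
    ∫ t in (0 : ℝ)..R, w * f (t * w) = F (R * w) - F 0 := by
  have hray : ∀ t : ℝ, HasDerivAt (fun t : ℝ => (t : ℂ) * w) w t := fun t => by
    simpa using (Complex.ofRealCLM.hasDerivAt (x := t)).mul_const w
  have hd : ∀ t ∈ Ici (0 : ℝ),
      HasDerivWithinAt (fun t : ℝ => F (t * w)) (w * f (t * w)) (Ici 0) t := fun t ht => by
    have := (hF _ (hw t ht)).scomp t (hray t).hasDerivWithinAt
      (fun s (hs : s ∈ Ici (0 : ℝ)) => hw s hs)
    simpa [Function.comp_def] using this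
  have hc : ContinuousOn (fun t : ℝ => w * f (t * w)) (Ici 0) :=
    continuousOn_const.mul (hf.comp (by fun_prop) fun s hs => hw s hs)
  have hsub : uIcc 0 R ⊆ Ici 0 := by rw [uIcc_of_le hR]; exact Icc_subset_Ici_self
  have := intervalIntegral.integral_eq_sub_of_hasDeriv_right (f := fun t : ℝ => F (t * w))
    (f' := fun t : ℝ => w * f (t * w)) (a := 0) (b := R)
    (fun t ht => ((hd t (hsub ht)).continuousWithinAt).mono hsub)
    (fun t ht => by
      rw [min_eq_left hR] at ht
      exact (hd t ht.1.le).mono fun s (hs : t < s) => (ht.1.trans hs).le)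
    ((hc.mono hsub).intervalIntegrable)
  simpa using this

/-- Rotation of the ray of integration: by Cauchy's theorem, in the form of a primitive of `f` on
the convex sector between the two rays, the integrals along them agree if `f` decays
exponentially in between. -/
lemma integral_ray_eq_of_differentiableOn_closedSector {f : ℂ → ℂ} {w : ℂ} {C ε : ℝ} (hε : 0 < ε)
    (hf : DifferentiableOn ℂ f (closedSector w))
    (hbd : ∀ᶠ R : ℝ in atTop, ∀ τ ∈ Icc (0 : ℝ) 1,
      ‖f (R * (1 + τ * (w - 1)))‖ ≤ C * Real.exp (-ε * R))
    (h1 : IntegrableOn (fun t : ℝ => f t) (Ioi 0))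
    (hw : IntegrableOn (fun t : ℝ => w * f (t * w)) (Ioi 0)) :
    ∫ t in Ioi (0 : ℝ), w * f (t * w) = ∫ t in Ioi (0 : ℝ), f t := by
  obtain ⟨F, hF⟩ := (convex_closedSector w).exists_forall_hasDerivWithinAt hf
  have hS : ∀ R τ : ℝ, 0 ≤ R → τ ∈ Icc (0 : ℝ) 1 →
      (R : ℂ) * (1 + τ * (w - 1)) ∈ closedSector w := fun R τ hR hτ =>
    ⟨R * (1 - τ), R * τ, mul_nonneg hR (by linarith [hτ.2]), mul_nonneg hR hτ.1, by
      push_cast; ring⟩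
  have hS1 : ∀ t : ℝ, 0 ≤ t → (t : ℂ) * 1 ∈ closedSector w := fun t ht => by
    simpa using hS t 0 ht (by simp)
  have hSw : ∀ t : ℝ, 0 ≤ t → (t : ℂ) * w ∈ closedSector w := fun t ht => by
    simpa using hS t 1 ht (by simp)
  have l1 := intervalIntegral_tendsto_integral_Ioi 0 h1 tendsto_id
  have lw := intervalIntegral_tendsto_integral_Ioi 0 hw tendsto_id
  have hlim : Tendsto (fun R : ℝ => C * ‖w - 1‖ * (R ^ 1 * Real.exp (-ε * R))) atTop (𝓝 0) := by
    have h := (Real.tendsto_pow_mul_exp_neg_atTop_nhds_zero 1).comp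
      (tendsto_id.const_mul_atTop hε)
    have h2 := h.const_mul (C * ‖w - 1‖ * ε⁻¹)
    rw [mul_zero] at h2
    refine h2.congr fun R => ?_
    simp only [Function.comp, id]
    field_simp
  have hdiff : Tendsto (fun R : ℝ => (∫ t in (0 : ℝ)..R, w * f (t * w)) -
      ∫ t in (0 : ℝ)..R, f t) atTop (𝓝 0) := by
    refine squeeze_zero_norm' ?_ hlim
    filter_upwards [hbd, eventually_ge_atTop 0] with R hR hR0
    have e1 := integral_ray_eq_sub hF hS1 hf.continuousOn hR0
    simp only [one_mul, mul_one] at e1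
    rw [integral_ray_eq_sub hF hSw hf.continuousOn hR0, e1, sub_sub_sub_cancel_right]
    have hseg : ∀ u ∈ segment ℝ ((R : ℂ)) (R * w), ∃ τ ∈ Icc (0 : ℝ) 1,
        u = R * (1 + τ * (w - 1)) := by
      rw [segment_eq_image]
      rintro _ ⟨τ, hτ, rfl⟩
      exact ⟨τ, hτ, by simp only [Complex.real_smul]; push_cast; ring⟩
    -- The segment joining the ends of the two rays is bounded by the mean value inequality.
    have hm := (convex_segment (𝕜 := ℝ) (R : ℂ) (R * w)).norm_image_sub_le_of_norm_hasDerivWithin_le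
      (f := F) (f' := f) (C := C * Real.exp (-ε * R)) (𝕜 := ℂ)
      (fun u hu => (hF u (by
        obtain ⟨τ, hτ, rfl⟩ := hseg u hu; exact hS R τ hR0 hτ)).mono (fun v hv => by
        obtain ⟨τ, hτ, rfl⟩ := hseg v hv; exact hS R τ hR0 hτ))
      (fun u hu => by obtain ⟨τ, hτ, rfl⟩ := hseg u hu; exact hR τ hτ)
      (left_mem_segment ℝ _ _) (right_mem_segment ℝ _ _)
    refine hm.trans (le_of_eq ?_)
    have : (R : ℂ) * w - R = R * (w - 1) := by ring
    rw [this, norm_mul, Complex.norm_real, Real.norm_of_nonneg hR0]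
    ring
  exact sub_eq_zero.1 (tendsto_nhds_unique (lw.sub l1) hdiff)

/-! ### The Lerch function as an integral along a ray -/

/-- The kernel `exp (-β u) / (1 - z exp (-u))` of the integral representation of the Lerch
function at `s = 1`, as a function of the complex variable `u`. -/
noncomputable def lerchKernel (z β u : ℂ) : ℂ :=
  Complex.exp (-β * u) / (1 - z * Complex.exp (-u))

lemma norm_lerchKernel_le {z β u : ℂ} (hz : ‖z‖ * Real.exp (-u.re) ≤ 1 / 2) :
    ‖lerchKernel z β u‖ ≤ 2 * Real.exp (-(β * u).re) := by
  have h : 1 / 2 ≤ ‖1 - z * Complex.exp (-u)‖ := by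
    have := norm_sub_norm_le (1 : ℂ) (z * Complex.exp (-u))
    rw [norm_mul, Complex.norm_exp, norm_one, Complex.neg_re] at this
    linarith
  rw [lerchKernel, norm_div, Complex.norm_exp, neg_mul, Complex.neg_re, mul_comm 2, div_eq_mul_inv]
  gcongr
  exact (inv_anti₀ (by norm_num) h).trans (by norm_num)

lemma eventually_norm_mul_exp_neg_le (z : ℂ) {c : ℝ} (hc : 0 < c) :
    ∀ᶠ t : ℝ in atTop, ‖z‖ * Real.exp (-(c * t)) ≤ 1 / 2 := by
  have h : Tendsto (fun t : ℝ => ‖z‖ * Real.exp (-(c * t))) atTop (𝓝 (‖z‖ * 0)) :=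
    ((Real.tendsto_exp_neg_atTop_nhds_zero).comp (tendsto_id.const_mul_atTop hc)).const_mul _
  rw [mul_zero] at h
  exact (h.eventually_lt_const (by norm_num)).mono fun t ht => ht.le

lemma integrableOn_lerchKernel_ray {z β w : ℂ} (hw : 0 < w.re) (hβ : 0 < (β * w).re)
    (hne : ∀ t : ℝ, 0 ≤ t → 1 - z * Complex.exp (-(t * w)) ≠ 0) :
    IntegrableOn (fun t : ℝ => lerchKernel z β (t * w)) (Ioi 0) := by
  have hcont : ContinuousOn (fun t : ℝ => lerchKernel z β (t * w)) (Ici 0) := by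
    unfold lerchKernel
    exact ContinuousOn.div (by fun_prop) (by fun_prop) fun t ht => hne t ht
  refine (integrable_norm_iff ((hcont.mono Ioi_subset_Ici_self).aestronglyMeasurable
    measurableSet_Ioi)).1 ?_
  refine integrable_of_isBigO_exp_neg hβ hcont.norm ?_
  refine Asymptotics.IsBigO.of_bound 2 ?_
  filter_upwards [eventually_norm_mul_exp_neg_le z hw] with t ht
  rw [norm_norm, Real.norm_of_nonneg (Real.exp_pos _).le]
  refine (norm_lerchKernel_le (by simpa [mul_comm] using ht)).trans (le_of_eq ?_)
  have : β * (t * w) = t * (β * w) := by ring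
  rw [this, Complex.re_ofReal_mul]
  congr 2; ring

/-- On the segment from `R` to `R * w` the real parts of `u` and `β * u` are convex combinations of
their values at the two ends, so the kernel decays uniformly there. -/
lemma integral_lerchKernel_ray_eq {z β w : ℂ} (hw : 0 < w.re) (hβ : 0 < β.re)
    (hβw : 0 < (β * w).re) (hne : ∀ u ∈ closedSector w, 1 - z * Complex.exp (-u) ≠ 0) :
    ∫ t in Ioi (0 : ℝ), w * lerchKernel z β (t * w) = ∫ t in Ioi (0 : ℝ), lerchKernel z β t := by
  have hmin {x y τ : ℝ} (h0 : 0 ≤ τ) (h1 : τ ≤ 1) : min x y ≤ (1 - τ) * x + τ * y := by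
    nlinarith [min_le_left x y, min_le_right x y]
  have hm1 : 0 < min 1 w.re := lt_min one_pos hw
  refine integral_ray_eq_of_differentiableOn_closedSector (C := 2) (ε := min β.re (β * w).re)
    (lt_min hβ hβw) ?_ ?_ ?_ ?_
  · unfold lerchKernel
    exact DifferentiableOn.div (by fun_prop) (by fun_prop) hne
  · filter_upwards [eventually_norm_mul_exp_neg_le z hm1, eventually_ge_atTop 0] with R hR hR0 τ hτ
    have e1 : ((R : ℂ) * (1 + τ * (w - 1))).re = R * ((1 - τ) * 1 + τ * w.re) := by
      rw [Complex.re_ofReal_mul, Complex.add_re, Complex.re_ofReal_mul, Complex.sub_re,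
        Complex.one_re]
      ring
    have e2 : (β * ((R : ℂ) * (1 + τ * (w - 1)))).re =
        R * ((1 - τ) * β.re + τ * (β * w).re) := by
      have : β * ((R : ℂ) * (1 + τ * (w - 1))) = R * ((1 - τ : ℝ) * β + τ * (β * w)) := by
        push_cast; ring
      rw [this, Complex.re_ofReal_mul, Complex.add_re, Complex.re_ofReal_mul,
        Complex.re_ofReal_mul]
    refine (norm_lerchKernel_le (le_trans ?_ hR)).trans ?_
    · rw [e1, mul_comm (min _ _) R]
      gcongr
      exact hmin hτ.1 hτ.2
    · rw [e2, neg_mul, mul_comm (min _ _) R]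
      gcongr
      exact hmin hτ.1 hτ.2
  · simpa using integrableOn_lerchKernel_ray (z := z) (β := β) (w := 1) (by simp)
      (by simpa using hβ)
      (fun t ht => hne _ ⟨t, 0, ht, le_rfl, by simp⟩)
  · exact (integrableOn_lerchKernel_ray hw hβw
      (fun t ht => hne _ ⟨0, t, le_rfl, ht, by simp⟩)).const_mul _

lemma integral_exp_neg_mul_ray {β w : ℂ} (hβ : 0 < (β * w).re) :
    ∫ t in Ioi (0 : ℝ), Complex.exp (-β * (t * w)) = 1 / (β * w) := by
  rw [← integral_exp_neg_mul_Ioi hβ]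
  congr 1 with t
  congr 1; ring

lemma integrableOn_exp_neg_mul_ray {β w : ℂ} (hβ : 0 < (β * w).re) :
    IntegrableOn (fun t : ℝ => Complex.exp (-β * (t * w))) (Ioi 0) := by
  refine (integrableOn_exp_neg_mul_Ioi hβ).congr_fun (fun t _ => ?_) measurableSet_Ioi
  simp only
  congr 1; ring

lemma re_add_natCast_mul_pos {v w : ℂ} (hw : 0 < w.re) (hv : 0 < (v * w).re) (k : ℕ) :
    0 < ((v + k) * w).re := by
  have : ((v + k) * w).re = (v * w).re + k * w.re := by simp; ring
  rw [this]; positivity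

lemma integral_lerchKernel_ray_eq_tsum {z v w : ℂ} (hz : ‖z‖ < 1) (hw : 0 < w.re)
    (hv : 0 < (v * w).re) :
    ∫ t in Ioi (0 : ℝ), w * lerchKernel z v (t * w) = ∑' k : ℕ, z ^ k * (v + k)⁻¹ := by
  have hw0 : w ≠ 0 := by rintro rfl; simp at hw
  have hpos := re_add_natCast_mul_pos hw hv
  have hF : ∀ k : ℕ, IntegrableOn (fun t : ℝ => w * z ^ k * Complex.exp (-(v + k) * (t * w)))
      (Ioi 0) := fun k => (integrableOn_exp_neg_mul_ray (hpos k)).const_mul _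
  have hexp := integrableOn_exp_neg_mul_ray hv
  have hbd : ∀ k : ℕ, ∫ t in Ioi (0 : ℝ), ‖w * z ^ k * Complex.exp (-(v + k) * (t * w))‖ ≤
      ‖w‖ * (∫ t in Ioi (0 : ℝ), ‖Complex.exp (-v * (t * w))‖) * ‖z‖ ^ k := fun k => by
    rw [mul_right_comm, ← integral_const_mul]
    refine setIntegral_mono_on (hF k).norm (hexp.norm.const_mul _) measurableSet_Ioi
      fun t (ht : 0 < t) => ?_
    rw [norm_mul, norm_mul, norm_pow, Complex.norm_exp, Complex.norm_exp]
    have e1 : (-(v + k) * (t * w)).re = -(t * ((v * w).re + k * w.re)) := by simp; ring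
    have e2 : (-v * (t * w)).re = -(t * (v * w).re) := by simp; ring
    rw [e1, e2]
    gcongr ?_ * ?_
    refine Real.exp_le_exp.2 (neg_le_neg (mul_le_mul_of_nonneg_left ?_ ht.le))
    nlinarith [mul_nonneg (Nat.cast_nonneg (α := ℝ) k) hw.le]
  have h := hasSum_integral_of_summable_integral_norm hF (Summable.of_nonneg_of_le
    (fun k => by positivity) hbd ((summable_geometric_of_lt_one (norm_nonneg z) hz).mul_left _))
  have hterm : ∀ k : ℕ, ∫ t in Ioi (0 : ℝ), w * z ^ k * Complex.exp (-(v + k) * (t * w)) =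
      z ^ k * (v + k)⁻¹ := fun k => by
    rw [integral_const_mul, integral_exp_neg_mul_ray (hpos k), one_div, mul_inv]
    field_simp
  simp_rw [hterm] at h
  rw [h.tsum_eq]
  refine setIntegral_congr_fun measurableSet_Ioi fun t (ht : 0 < t) => ?_
  have hr : ‖z * Complex.exp (-(t * w))‖ < 1 := by
    rw [norm_mul, Complex.norm_exp]
    refine (mul_le_of_le_one_right (norm_nonneg z) ?_).trans_lt hz
    rw [Real.exp_le_one_iff]
    simp
    positivity
  have hg := (hasSum_geometric_of_norm_lt_one hr).mul_left (w * Complex.exp (-v * (t * w)))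
  simp only [lerchKernel]
  rw [div_eq_mul_inv, ← mul_assoc, ← hg.tsum_eq]
  refine tsum_congr fun k => ?_
  rw [mul_pow, ← Complex.exp_nat_mul,
    show -(v + k) * (t * w) = -v * (t * w) + k * -(t * w) by ring, Complex.exp_add]
  ring

/-- The terms `z ^ k / (v + k)`, `k < K`, are split off by the finite geometric sum. This works
along the ray even where `Re v` is not positive. -/
lemma integral_lerchKernel_ray_eq_sum_add {z v w : ℂ} (hw : 0 < w.re) (hv : 0 < (v * w).re)
    (hne : ∀ t : ℝ, 0 ≤ t → 1 - z * Complex.exp (-(t * w)) ≠ 0) (K : ℕ) :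
    ∫ t in Ioi (0 : ℝ), w * lerchKernel z v (t * w) =
      (∑ k ∈ Finset.range K, z ^ k * (v + k)⁻¹) +
        z ^ K * ∫ t in Ioi (0 : ℝ), w * lerchKernel z (v + K) (t * w) := by
  have hw0 : w ≠ 0 := by rintro rfl; simp at hw
  have hpos := re_add_natCast_mul_pos hw hv
  induction K with
  | zero => simp
  | succ K ih =>
    rw [ih, Finset.sum_range_succ, add_assoc]
    congr 1
    have e : ∀ t ∈ Ioi (0 : ℝ), w * lerchKernel z (v + K) (t * w) =
        w * Complex.exp (-(v + K) * (t * w)) +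
          z * (w * lerchKernel z (v + (K + 1 : ℕ)) (t * w)) := fun t (ht : 0 < t) => by
      have := hne t ht.le
      simp only [lerchKernel]
      rw [show -(v + (K + 1 : ℕ)) * (t * w) = -(v + K) * (t * w) + -(t * w) by push_cast; ring,
        Complex.exp_add]
      have h1 : (1 - z * Complex.exp (-(t * w)))⁻¹ * (1 - z * Complex.exp (-(t * w))) = 1 :=
        inv_mul_cancel₀ this
      rw [div_eq_mul_inv, div_eq_mul_inv]
      linear_combination w * Complex.exp (-(v + K) * (t * w)) * h1
    rw [setIntegral_congr_fun measurableSet_Ioi e, integral_add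
      ((integrableOn_exp_neg_mul_ray (hpos K)).const_mul _)
      (((integrableOn_lerchKernel_ray hw (hpos (K + 1)) hne).const_mul _).const_mul _),
      integral_const_mul, integral_const_mul z, integral_exp_neg_mul_ray (hpos K)]
    have hvK : v + K ≠ 0 := fun h => by simpa [h] using hpos K
    field_simp
    ring

/-- The integral along the ray `w · (0, ∞)` computes the Lerch function as soon as no pole of the
kernel lies between that ray and the positive real axis, a condition that is needed only where
the Lerch function is not given by its series. -/
lemma integral_lerchKernel_ray_eq_lerchPhi {z v w : ℂ} (hw : 0 < w.re) (hv : 0 < (v * w).re)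
    (hne : 1 ≤ ‖z‖ → ∀ u ∈ closedSector w, 1 - z * Complex.exp (-u) ≠ 0) :
    ∫ t in Ioi (0 : ℝ), w * lerchKernel z v (t * w) = lerchPhi z 1 v := by
  unfold lerchPhi
  split_ifs with hz
  · simp_rw [Complex.cpow_neg_one]
    exact integral_lerchKernel_ray_eq_tsum hz hw hv
  · replace hne := hne (not_lt.1 hz)
    -- The floor in the definition is just large enough to make the shifted parameter positive.
    have hre : 0 < (v + (⌊1 - v.re⌋₊ : ℕ)).re := by
      simpa using by linarith [Nat.lt_floor_add_one (1 - v.re)]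
    simp only [Complex.cpow_neg_one, sub_self, Complex.cpow_zero, Complex.Gamma_one, inv_one,
      one_mul]
    rw [integral_lerchKernel_ray_eq_sum_add hw hv
      (fun t ht => hne _ ⟨0, t, le_rfl, ht, by simp⟩) ⌊1 - v.re⌋₊,
      integral_lerchKernel_ray_eq hw hre (re_add_natCast_mul_pos hw hv _) hne]
    rfl

/-! ### The position of the poles of the kernel -/

/-- Coordinates of the poles of the kernel: if `x + y π / l = i π (N / l - 2 k)`, then imaginary
parts, taken before and after multiplication by `l`, determine `y Im l` and `x Im l`. -/
lemma im_mul_eq_of_one_sub_exp_mul_exp_eq_zero {N l : ℂ} (hl : l ≠ 0) {x y : ℝ}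
    (h : 1 - Complex.exp (Complex.I * N * Real.pi / l) *
      Complex.exp (-(x + y * (Real.pi / l))) = 0) :
    ∃ k : ℤ, x * l.im = Real.pi * (N.re - 2 * k * l.re) ∧
      -(y * l.im) = Complex.normSq l * ((N / l).re - 2 * k) := by
  have h1 := (sub_eq_zero.1 h).symm
  rw [← Complex.exp_add, Complex.exp_eq_one_iff] at h1
  obtain ⟨k, hk⟩ := h1
  have hpi : (Real.pi : ℂ) ≠ 0 := by exact_mod_cast Real.pi_ne_zero
  refine ⟨k, ?_, ?_⟩
  · have e : (x : ℂ) * l =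
        Complex.I * ((Real.pi : ℝ) * (N - (2 * k : ℝ) * l)) - (y * Real.pi : ℝ) := by
      field_simp at hk
      push_cast
      linear_combination -hk
    have := congrArg Complex.im e
    simpa using this
  · have e : ((y * Real.pi : ℝ) : ℂ) * l⁻¹ =
        Complex.I * ((Real.pi : ℝ) * (N / l - (2 * k : ℝ))) - (x : ℝ) := by
      push_cast
      linear_combination -hk
    have h2 := congrArg Complex.im e
    rw [Complex.im_ofReal_mul, Complex.inv_im] at h2
    simp at h2
    have hn : Complex.normSq l ≠ 0 := by simpa using hl
    field_simp at h2
    exact h2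

/-- The poles `i π (N / l - 2 k)` of the kernel avoid the sector between the rays through `1` and
`π / l`: such a pole is on the same side of both rays, above them for `k ≤ 0` and below them for
`k ≥ 1`. -/
lemma one_sub_exp_mul_exp_neg_ne_zero_of_mem_closedSector {N l : ℂ} (hN0 : 0 < N.re)
    (hN1 : N.re < 2 * l.re) (h0 : 0 < (N / l).re) (h2 : (N / l).re < 2) {u : ℂ}
    (hu : u ∈ closedSector (Real.pi / l)) :
    1 - Complex.exp (Complex.I * N * Real.pi / l) * Complex.exp (-u) ≠ 0 := by
  obtain ⟨x, y, hx, hy, rfl⟩ := hu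
  intro h
  have hlre : 0 < l.re := by linarith
  have hl : l ≠ 0 := by rintro rfl; simp at hlre
  have hn : 0 < Complex.normSq l := Complex.normSq_pos.2 hl
  obtain ⟨k, hk1, hk2⟩ := im_mul_eq_of_one_sub_exp_mul_exp_eq_zero hl h
  have hpi := Real.pi_pos
  rcases le_or_gt k 0 with hk | hk
  · have hk' : (k : ℝ) ≤ 0 := by exact_mod_cast hk
    have p1 : 0 < Real.pi * (N.re - 2 * k * l.re) := mul_pos hpi (by nlinarith)
    have p2 : 0 < Complex.normSq l * ((N / l).re - 2 * k) := mul_pos hn (by linarith)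
    rw [← hk1] at p1
    rw [← hk2] at p2
    rcases le_total l.im 0 with hi | hi
    · linarith [mul_nonneg hx (neg_nonneg.2 hi)]
    · linarith [mul_nonneg hy hi]
  · have hk' : (1 : ℝ) ≤ k := by exact_mod_cast hk
    have p1 : Real.pi * (N.re - 2 * k * l.re) < 0 := mul_neg_of_pos_of_neg hpi (by nlinarith)
    have p2 : Complex.normSq l * ((N / l).re - 2 * k) < 0 :=
      mul_neg_of_pos_of_neg hn (by linarith)
    rw [← hk1] at p1
    rw [← hk2] at p2
    rcases le_total l.im 0 with hi | hi
    · linarith [mul_nonneg hy (neg_nonneg.2 hi)]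
    · linarith [mul_nonneg hx hi]

lemma one_sub_exp_mul_exp_neg_ray_ne_zero {N l : ℂ} (hN0 : 0 < N.re) (hN1 : N.re < 2 * l.re)
    (t : ℝ) :
    1 - Complex.exp (Complex.I * N * Real.pi / l) * Complex.exp (-(t * (Real.pi / l))) ≠ 0 := by
  intro h
  have hlre : 0 < l.re := by linarith
  have hl : l ≠ 0 := by rintro rfl; simp at hlre
  obtain ⟨k, hk, -⟩ := im_mul_eq_of_one_sub_exp_mul_exp_eq_zero (x := 0) (y := t) hl
    (by simpa using h)
  rw [zero_mul, eq_comm, mul_eq_zero, or_iff_right Real.pi_ne_zero] at hk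
  rcases le_or_gt k 0 with hk0 | hk0
  · have hk' : (k : ℝ) ≤ 0 := by exact_mod_cast hk0
    nlinarith
  · have hk' : (1 : ℝ) ≤ k := by exact_mod_cast hk0
    nlinarith

lemma re_pi_div_pos {l : ℂ} (hl : 0 < l.re) : 0 < ((Real.pi : ℂ) / l).re := by
  rw [div_eq_mul_inv, Complex.re_ofReal_mul, Complex.inv_re]
  have : 0 < Complex.normSq l := Complex.normSq_pos.2 (by rintro rfl; simp at hl)
  have := Real.pi_pos
  positivity

lemma re_mul_div_add_one_mul_pos {a l : ℂ} (ha : 0 < a.re) (hl : 0 < l.re) :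
    0 < ((a * l / Real.pi + 1) * (Real.pi / l)).re := by
  have hl0 : l ≠ 0 := by rintro rfl; simp at hl
  have hpi : (Real.pi : ℂ) ≠ 0 := by exact_mod_cast Real.pi_ne_zero
  have e : (a * l / Real.pi + 1) * (Real.pi / l) = a + Real.pi / l := by field_simp
  rw [e, Complex.add_re]
  exact add_pos ha (re_pi_div_pos hl)

/-- The sector between the two rays need only be free of poles when `‖z‖ ≥ 1`, that is, when
`Im (N / l) ≤ 0`; this excludes the first alternative of the hypothesis. -/
lemma integral_ray_pi_div_eq_lerchPhi {N l a : ℂ} (ha : 0 < a.re) (hN0 : 0 < N.re)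
    (hN1 : N.re < 2 * l.re)
    (hN : 0 < (N / l).im ∨ (0 < (N / l).re ∧ (N / l).re < 2)) :
    ∫ t in Ioi (0 : ℝ), Real.pi / l * lerchKernel (Complex.exp (Complex.I * N * Real.pi / l))
        (a * l / Real.pi + 1) (t * (Real.pi / l)) =
      lerchPhi (Complex.exp (Complex.I * N * Real.pi / l)) 1 (a * l / Real.pi + 1) := by
  have hlre : 0 < l.re := by linarith
  refine integral_lerchKernel_ray_eq_lerchPhi (re_pi_div_pos hlre)
    (re_mul_div_add_one_mul_pos ha hlre) fun hz u hu => ?_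
  have him : (N / l).im ≤ 0 := by
    have e : Complex.I * N * Real.pi / l = Complex.I * ((Real.pi : ℝ) * (N / l)) := by ring
    rw [e, Complex.norm_exp, Real.one_le_exp_iff, Complex.I_mul_re, Complex.im_ofReal_mul] at hz
    nlinarith [Real.pi_pos]
  have hre := hN.resolve_left him.not_gt
  exact one_sub_exp_mul_exp_neg_ne_zero_of_mem_closedSector hN0 hN1 hre.1 hre.2 hu

/-! ### The substitution `x = exp t` -/

lemma integrableOn_Ioi_zero_iff_integrable_comp_exp {f : ℝ → ℂ} :
    IntegrableOn f (Ioi 0) ↔ Integrable fun t : ℝ => (Real.exp t : ℂ) * f (Real.exp t) := by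
  have h := integrableOn_image_iff_integrableOn_abs_deriv_smul (s := univ) MeasurableSet.univ
    (fun x _ => (Real.hasDerivAt_exp x).hasDerivWithinAt) Real.exp_injective.injOn f
  rw [image_univ, Real.range_exp, integrableOn_univ] at h
  simpa using h

lemma integral_Ioi_zero_eq_integral_comp_exp (f : ℝ → ℂ) :
    ∫ x in Ioi (0 : ℝ), f x = ∫ t : ℝ, (Real.exp t : ℂ) * f (Real.exp t) := by
  have h := integral_image_eq_integral_abs_deriv_smul (s := univ) MeasurableSet.univ
    (fun x _ => (Real.hasDerivAt_exp x).hasDerivWithinAt) Real.exp_injective.injOn f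
  rw [image_univ, Real.range_exp, setIntegral_univ] at h
  simpa using h

lemma ofReal_add_I_mul_ne_zero {a : ℂ} (ha : a.re ≠ 0) (t : ℝ) : (t : ℂ) + Complex.I * a ≠ 0 :=
  fun h => ha (by simpa using congrArg Complex.im h)

/-- After `x = exp t` the two terms combine, since `a² + t² = (t + i a) (t - i a)`. -/
lemma exp_mul_logDenomIntegrand_exp (m n l : ℂ) {a : ℂ} (ha : a.re ≠ 0) (t : ℝ) :
    (Real.exp t : ℂ) * logDenomIntegrand m n l a (Real.exp t) =
      (Complex.exp ((2 * n + 1) * t) - Complex.exp ((2 * m + 1) * t)) /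
        (Complex.exp (2 * l * t) - 1) / (t + Complex.I * a) := by
  have hpow (c : ℂ) : (Real.exp t : ℂ) ^ c = Complex.exp (c * t) := by
    rw [Complex.cpow_def_of_ne_zero (by simp), ← Complex.ofReal_log (Real.exp_pos t).le,
      Real.log_exp, mul_comm]
  have hadd (c : ℂ) : Complex.exp ((c + 1) * t) = Complex.exp t * Complex.exp (c * t) := by
    rw [← Complex.exp_add]; congr 1; ring
  have h1 := ofReal_add_I_mul_ne_zero ha t
  have h2 : (t : ℂ) - Complex.I * a ≠ 0 := by
    simpa [sub_eq_add_neg] using ofReal_add_I_mul_ne_zero (a := -a) (by simpa using ha) t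
  have hfac : a ^ 2 + (t : ℂ) ^ 2 = (t + Complex.I * a) * (t - Complex.I * a) := by
    linear_combination a ^ 2 * Complex.I_sq
  rw [logDenomIntegrand, hpow, hpow, hpow, Real.log_exp, Complex.ofReal_exp, hadd, hadd, hfac]
  -- At `t = 0` the factor `exp (2 l t) - 1` vanishes, so it is kept as an opaque inverse.
  simp only [div_eq_mul_inv, mul_inv]
  have h3 := mul_inv_cancel₀ h2
  linear_combination Complex.exp t * (Complex.exp (2 * n * t) - Complex.exp (2 * m * t)) *
    (Complex.exp (2 * l * t) - 1)⁻¹ * (t + Complex.I * a)⁻¹ * h3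

/-! ### Evaluation of the integral -/

/-- The cotangent formula at the frequencies shifted by `i s`, in terms of the kernel at the point
`s π / l`. -/
lemma exp_neg_mul_integral_exp_sub_exp_div_mul_exp {M N l : ℂ} (a : ℂ) (hM0 : 0 < M.re)
    (hM1 : M.re < 2 * l.re) (hN0 : 0 < N.re) (hN1 : N.re < 2 * l.re) (s : ℝ) :
    Complex.exp (-a * s) * ∫ t : ℝ, (Complex.exp (N * t) - Complex.exp (M * t)) /
        (Complex.exp (2 * l * t) - 1) * Complex.exp (Complex.I * s * t) =
      Complex.I * (Complex.exp (Complex.I * N * Real.pi / l) * (Real.pi / l *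
          lerchKernel (Complex.exp (Complex.I * N * Real.pi / l)) (a * l / Real.pi + 1)
            (s * (Real.pi / l))) -
        Complex.exp (Complex.I * M * Real.pi / l) * (Real.pi / l *
          lerchKernel (Complex.exp (Complex.I * M * Real.pi / l)) (a * l / Real.pi + 1)
            (s * (Real.pi / l)))) := by
  have hlre : 0 < l.re := by linarith
  have hl : l ≠ 0 := by rintro rfl; simp at hlre
  have hpi : (Real.pi : ℂ) ≠ 0 := by exact_mod_cast Real.pi_ne_zero
  have hre (P : ℂ) : (P + Complex.I * s).re = P.re := by simp
  have h2l : (2 * l).re = 2 * l.re := by simp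
  have hint := integral_exp_sub_exp_div_exp_sub_one (p := N + Complex.I * s)
    (q := M + Complex.I * s) (L := 2 * l) (by rwa [hre]) (by rwa [hre, h2l]) (by rwa [hre])
    (by rwa [hre, h2l])
  have hw (P : ℂ) : Complex.exp (Complex.I * P * Real.pi / l) *
      Complex.exp (-(s * (Real.pi / l))) =
      Complex.exp (2 * Real.pi * Complex.I * ((P + Complex.I * s) / (2 * l))) := by
    rw [← Complex.exp_add]
    congr 1
    field_simp
    linear_combination -(s : ℂ) * Complex.I_sq
  have hker (P : ℂ) : Complex.exp (-a * s) * (Complex.exp (Complex.I * P * Real.pi / l) *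
        Complex.exp (-(s * (Real.pi / l))) / (1 - Complex.exp (Complex.I * P * Real.pi / l) *
        Complex.exp (-(s * (Real.pi / l))))) = Complex.exp (Complex.I * P * Real.pi / l) *
      lerchKernel (Complex.exp (Complex.I * P * Real.pi / l)) (a * l / Real.pi + 1)
            (s * (Real.pi / l)) := by
    have e : -(a * l / Real.pi + 1) * (s * (Real.pi / l)) = -a * s + -(s * (Real.pi / l)) := by
      field_simp
      ring
    rw [lerchKernel, e, Complex.exp_add]
    ring
  rw [cot_pi_mul_eq (hw N) (one_sub_exp_mul_exp_neg_ray_ne_zero hN0 hN1 s),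
    cot_pi_mul_eq (hw M) (one_sub_exp_mul_exp_neg_ray_ne_zero hM0 hM1 s)] at hint
  have e : ∀ t : ℝ, (Complex.exp (N * t) - Complex.exp (M * t)) /
        (Complex.exp (2 * l * t) - 1) * Complex.exp (Complex.I * s * t) =
      (Complex.exp ((N + Complex.I * s) * t) - Complex.exp ((M + Complex.I * s) * t)) /
        (Complex.exp (2 * l * t) - 1) := fun t => by
    rw [add_mul, add_mul, Complex.exp_add, Complex.exp_add]; ring
  simp_rw [e]
  rw [hint]
  linear_combination Complex.I * Real.pi / l * (hker N - hker M)

theorem mainTheorem8 (m n l a : ℂ) (ha : 0 < a.re)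
    (hm₀ : 0 < (2 * m + 1).re) (hm₁ : (2 * m + 1).re < 2 * l.re)
    (hn₀ : 0 < (2 * n + 1).re) (hn₁ : (2 * n + 1).re < 2 * l.re)
    (hm : 0 < ((2 * m + 1) / l).im ∨
      (0 < ((2 * m + 1) / l).re ∧ ((2 * m + 1) / l).re < 2))
    (hn : 0 < ((2 * n + 1) / l).im ∨
      (0 < ((2 * n + 1) / l).re ∧ ((2 * n + 1) / l).re < 2)) :
    MeasureTheory.IntegrableOn (logDenomIntegrand m n l a) (Set.Ioi 0) ∧
    ∫ x in Set.Ioi (0 : ℝ), logDenomIntegrand m n l a x =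
      Complex.exp (Complex.I * Real.pi / l) *
        (Complex.exp (2 * Complex.I * Real.pi * n / l) *
            lerchPhi (Complex.exp (Complex.I * (2 * n + 1) * Real.pi / l)) 1
              (a * l / Real.pi + 1) -
          Complex.exp (2 * Complex.I * Real.pi * m / l) *
            lerchPhi (Complex.exp (Complex.I * (2 * m + 1) * Real.pi / l)) 1
              (a * l / Real.pi + 1)) := by
  have hlre : 0 < l.re := by linarith
  have h2l : (2 * l).re = 2 * l.re := by simp
  have hg := integrable_exp_sub_exp_div_exp_sub_one (L := 2 * l) hn₀ (by rwa [h2l]) hm₀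
    (by rwa [h2l])
  constructor
  · rw [integrableOn_Ioi_zero_iff_integrable_comp_exp]
    simp_rw [exp_mul_logDenomIntegrand_exp m n l ha.ne']
    have hbd : ∀ t : ℝ, ‖((t : ℂ) + Complex.I * a)⁻¹‖ ≤ a.re⁻¹ := fun t => by
      rw [norm_inv]
      refine inv_anti₀ ha ?_
      refine le_trans ?_ (Complex.abs_im_le_norm _)
      simpa using le_abs_self a.re
    simp_rw [div_eq_mul_inv _ (_ + Complex.I * a)]
    exact hg.mul_bdd (c := a.re⁻¹) (Measurable.aestronglyMeasurable (by fun_prop))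
      (Eventually.of_forall hbd)
  · have hker : ∀ P : ℂ, 0 < P.re → P.re < 2 * l.re → IntegrableOn (fun t : ℝ =>
        Complex.exp (Complex.I * P * Real.pi / l) * (Real.pi / l *
          lerchKernel (Complex.exp (Complex.I * P * Real.pi / l)) (a * l / Real.pi + 1)
            (t * (Real.pi / l)))) (Ioi 0) := fun P hP0 hP1 =>
      ((integrableOn_lerchKernel_ray (re_pi_div_pos hlre) (re_mul_div_add_one_mul_pos ha hlre)
        fun t _ => one_sub_exp_mul_exp_neg_ray_ne_zero hP0 hP1 t).const_mul _).const_mul _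
    rw [integral_Ioi_zero_eq_integral_comp_exp]
    simp_rw [exp_mul_logDenomIntegrand_exp m n l ha.ne']
    rw [integral_div_add_I_mul hg ha]
    simp_rw [exp_neg_mul_integral_exp_sub_exp_div_mul_exp a hm₀ hm₁ hn₀ hn₁]
    rw [integral_const_mul, integral_sub (hker _ hn₀ hn₁) (hker _ hm₀ hm₁),
      integral_const_mul (Complex.exp (Complex.I * (2 * n + 1) * Real.pi / l)),
      integral_const_mul (Complex.exp (Complex.I * (2 * m + 1) * Real.pi / l)),
      integral_ray_pi_div_eq_lerchPhi ha hn₀ hn₁ hn,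
      integral_ray_pi_div_eq_lerchPhi ha hm₀ hm₁ hm]
    have hz (P : ℂ) : Complex.exp (Complex.I * (2 * P + 1) * Real.pi / l) =
        Complex.exp (Complex.I * Real.pi / l) * Complex.exp (2 * Complex.I * Real.pi * P / l) := by
      rw [← Complex.exp_add]; congr 1; ring
    rw [← mul_assoc, neg_mul, Complex.I_mul_I, neg_neg, one_mul, mul_sub, ← mul_assoc, ← mul_assoc,
      ← hz, ← hz]
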